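/- Theorem (Expected hitting time to the perfect squares). Let $X_1,X_2,\dots$ be independent rolls of a fair six-sided die, i.e. i.i.d. random variables uniformly distributed on $\{1,\dots,6\}$. Put $S_0=0$ and $S_t=X_1+\dots+X_t$, let $T=\inf\{t\ge 0: S_t=n^2\text{ for some integer }n\ge 1\}$ (with $\inf\emptyset=\infty$), and let $E(0)=\mathbb{E}[T]$ be the expected number of rolls until the cumulative sum is a positive perfect square. Then $E(0)$ is finite, and its decimal expansion, truncated after 1,017 decimal places, is \[ \begin{aligned} c={}&7.079764237551105103895553056908184894681711444263208805908873\\ &101517293030636657289150619440215929586140643853058236617839\\ &038805437427037161983225198843501869295681377649823444071523\\ &388800882074553106810227935191220149739931296954376558933192\\ &195369394958351011153114111799919088138505138599357264273458\\ &295534653653705548720477130373704649449607046275208840820791\\ &615363183593786984085594202052884475208247842900518291457801\\ &426255494832590823030504774813684129030383618661091994729346\\ &316899126658258686744721776623692164339998786486070630256359\\ &172293213930131126660661305353727091275283033821909596371164\\ &463346351343143276559533679088929433795409592073773399518296\\ &416540470294895323623629224992997477760853053903893989731353\\ &287187931136704436094234746646663976703439467712341171718619\\ &085317407308552387899094073533086262057687143557474061763457\\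 &398136241182138420814929896478348546126586312504509048656042\\ &736191857511098779116613148179664850379978987656091676501299\\ &944201086790790737071543289307884197271970205089906775387 \end{aligned} \] (one digit before and 1,017 digits after the decimal point); that is, $c\le E(0)<c+10^{-1017}$. -/

import Mathlib

open MeasureTheory ProbabilityTheory
open scoped ENNReal

/-- The cumulative sum `S_t = s + X_1 + ... + X_t` after `t` rolls, starting at `s`
(the rolls are indexed from `0`, so that `X i` is roll number `i + 1`). -/
def cumulativeSum {Ω : Type*} (X : ℕ → Ω → ℕ) (s : ℕ) (t : ℕ) (ω : Ω) : ℕ :=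
  s + ∑ i ∈ Finset.range t, X i ω

/-- The hitting time `T = inf {t ≥ 0 : S_t ∈ H}` of the target set `H`
(equal to `⊤` where the cumulative sum never enters `H`). -/
noncomputable def rollsToHit {Ω : Type*} (X : ℕ → Ω → ℕ) (H : Set ℕ) (s : ℕ) : Ω → ℕ∞ :=
  hittingAfter (cumulativeSum X s) H 0

/-- The expected number of rolls `E(s) = 𝔼_s[T]`, with values in `[0, ∞]`. -/
noncomputable def expectedRolls {Ω : Type*} [MeasurableSpace Ω] (μ : Measure Ω)
    (X : ℕ → Ω → ℕ) (H : Set ℕ) (s : ℕ) : ℝ≥0∞ :=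
  ∫⁻ ω, (rollsToHit X H s ω : ℝ≥0∞) ∂μ

/-- The positive perfect squares `{n² : n ≥ 1}`. -/
def positiveSquares : Set ℕ := {m | ∃ n : ℕ, 1 ≤ n ∧ m = n ^ 2}

/-- The displayed number `7.0797642375511051...`, with one digit before and `1017` digits after
the decimal point. -/
noncomputable def displayedValue : ℝ :=
  7079764237551105103895553056908184894681711444263208805908873101517293030636657289150619440215929586140643853058236617839038805437427037161983225198843501869295681377649823444071523388800882074553106810227935191220149739931296954376558933192195369394958351011153114111799919088138505138599357264273458295534653653705548720477130373704649449607046275208840820791615363183593786984085594202052884475208247842900518291457801426255494832590823030504774813684129030383618661091994729346316899126658258686744721776623692164339998786486070630256359172293213930131126660661305353727091275283033821909596371164463346351343143276559533679088929433795409592073773399518296416540470294895323623629224992997477760853053903893989731353287187931136704436094234746646663976703439467712341171718619085317407308552387899094073533086262057687143557474061763457398136241182138420814929896478348546126586312504509048656042736191857511098779116613148179664850379978987656091676501299944201086790790737071543289307884197271970205089906775387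
    / 10 ^ 1017

/-!
The expected number of rolls is the expected number of positions, squares excluded, that the walk
visits before it hits a positive square (`expectedRolls_eq_tsum_occupation`), and the visiting
probabilities satisfy a linear recurrence of order six, interrupted at the squares.

By Wald's identity, `7 / 2` times this expectation is the expected distance covered. Counting the
distance level by level turns it into `∑ (2 * k + 1) * survival k`, where `survival k` is the
probability that none of `1, 4, …, k ^ 2` is hit and `2 * k + 1` is the number of levels in
`[k ^ 2, (k + 1) ^ 2)` (`sum_squareOcc_sq`).

Between two squares the walk is an ordinary renewal process started from its overshoot over the
first square, so the five probabilities of visiting `n ^ 2 - 5, …, n ^ 2 - 1` determine those for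
`n + 1` through nine consecutive renewal probabilities (`squareOcc_succ_sq`). So `survival k` is
computable in one step per square rather than one per position. Integer arithmetic at scale
`2 ^ 3460`, once with all quotients rounded down and once with all of them rounded up, encloses
these quantities up to `n = 4099`, at which `survival n` is about `10 ^ (-599)`
(`Encloses.iter`, `lower_certificate`, `upper_certificate`).

The tail of the series is controlled analytically. Renewal probabilities are averages of the
preceding six, hence once six of them are within `η / 7` of the limit `2 / 7`, all later ones are
(`renewal_mem_Icc`). Then `survival` decays by a factor close to `5 / 7` from one square to the
next, and the tail from `n` on is `(7 * n + 21) * survival n` up to a relative error `10 * η`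
(`summable_squareOcc_and_bounds`).
-/

/-! ### Reduction to a linear recurrence -/

open scoped Classical in
/-- `occupation H (m + 5)` is the probability that the sum of the rolls, started at `0`, visits `m`
before entering `H` and `m` itself is not in `H`. The five leading zeros stand for the positions
`-5, …, -1`, which makes the recurrence uniform. It is assumed throughout that `0 ∉ H`. -/
noncomputable def occupation (H : Set ℕ) : ℕ → ℝ
  | 0 => 0
  | 1 => 0
  | 2 => 0
  | 3 => 0
  | 4 => 0
  | 5 => 1
  | k + 6 => if k + 1 ∈ H then 0 else
      (occupation H k + occupation H (k + 1) + occupation H (k + 2) + occupation H (k + 3)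
        + occupation H (k + 4) + occupation H (k + 5)) / 6

theorem occupation_of_mem {H : Set ℕ} {k : ℕ} (h : k + 1 ∈ H) : occupation H (k + 6) = 0 := by
  rw [occupation, if_pos h]

theorem occupation_of_notMem {H : Set ℕ} {k : ℕ} (h : k + 1 ∉ H) :
    occupation H (k + 6) = (occupation H k + occupation H (k + 1) + occupation H (k + 2)
      + occupation H (k + 3) + occupation H (k + 4) + occupation H (k + 5)) / 6 := by
  rw [occupation, if_neg h]

theorem occupation_nonneg (H : Set ℕ) (k : ℕ) : 0 ≤ occupation H k := by
  induction k using Nat.strong_induction_on with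
  | _ k ih =>
    match k with
    | 0 | 1 | 2 | 3 | 4 | 5 => simp [occupation]
    | k + 6 =>
      by_cases h : k + 1 ∈ H
      · rw [occupation_of_mem h]
      · rw [occupation_of_notMem h]
        have := ih k (by omega)
        have := ih (k + 1) (by omega)
        have := ih (k + 2) (by omega)
        have := ih (k + 3) (by omega)
        have := ih (k + 4) (by omega)
        have := ih (k + 5) (by omega)
        positivity

theorem cumulativeSum_succ {Ω : Type*} (X : ℕ → Ω → ℕ) (s t : ℕ) (ω : Ω) :
    cumulativeSum X s (t + 1) ω = cumulativeSum X s t ω + X t ω := by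
  simp [cumulativeSum, Finset.sum_range_succ, add_assoc]

theorem natCast_lt_rollsToHit_iff {Ω : Type*} (X : ℕ → Ω → ℕ) (H : Set ℕ) (s t : ℕ) (ω : Ω) :
    (t : ℕ∞) < rollsToHit X H s ω ↔ ∀ j ≤ t, cumulativeSum X s j ω ∉ H := by
  rw [← not_le]
  have h : rollsToHit X H s ω ≤ (t : ℕ∞) ↔ ∃ j ∈ Set.Icc 0 t, cumulativeSum X s j ω ∈ H :=
    hittingAfter_le_iff
  rw [h]
  simp

/-- The layer-cake formula `n = #{t | t < n}`, valid also for `n = ⊤`. -/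
theorem ENat.toENNReal_eq_tsum_ite (n : ℕ∞) :
    (n : ℝ≥0∞) = ∑' t : ℕ, if (t : ℕ∞) < n then 1 else 0 := by
  induction n using ENat.recTopCoe with
  | top => simp
  | coe n =>
    rw [tsum_eq_sum (s := Finset.range n)]
    · rw [Finset.sum_congr rfl (g := fun _ => 1)]
      · simp
      · intro x hx
        simp [Finset.mem_range.1 hx]
    · intro b hb
      simpa using hb

section Probability

variable {Ω : Type*} [MeasurableSpace Ω] {μ : Measure Ω} {X : ℕ → Ω → ℕ} {H : Set ℕ}

theorem measurable_cumulativeSum (hmeas : ∀ i, Measurable (X i)) (s t : ℕ) :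
    Measurable (cumulativeSum X s t) := by
  unfold cumulativeSum
  fun_prop

theorem measurableSet_avoid (hmeas : ∀ i, Measurable (X i)) (s t : ℕ) :
    MeasurableSet {ω | ∀ j ≤ t, cumulativeSum X s j ω ∉ H} := by
  have : {ω | ∀ j ≤ t, cumulativeSum X s j ω ∉ H}
      = ⋂ j ∈ Finset.Iic t, (cumulativeSum X s j) ⁻¹' Hᶜ := by ext; simp
  rw [this]
  exact Finset.measurableSet_biInter _ fun j _ =>
    measurable_cumulativeSum hmeas s j (MeasurableSet.of_discrete)

theorem expectedRolls_eq_tsum (hmeas : ∀ i, Measurable (X i)) (s : ℕ) :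
    expectedRolls μ X H s = ∑' t, μ {ω | ∀ j ≤ t, cumulativeSum X s j ω ∉ H} := by
  unfold expectedRolls
  have h : ∀ ω, ((rollsToHit X H s ω : ℕ∞) : ℝ≥0∞) =
      ∑' t, Set.indicator {ω | ∀ j ≤ t, cumulativeSum X s j ω ∉ H} (1 : Ω → ℝ≥0∞) ω := by
    intro ω
    rw [ENat.toENNReal_eq_tsum_ite]
    refine tsum_congr fun t => ?_
    classical
    rw [Set.indicator_apply]
    exact if_congr (natCast_lt_rollsToHit_iff X H s t ω) rfl rfl
  simp_rw [h]
  rw [lintegral_tsum fun t =>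
    (measurable_one.indicator (measurableSet_avoid hmeas s t)).aemeasurable]
  exact tsum_congr fun t => lintegral_indicator_one (measurableSet_avoid hmeas s t)

theorem measurableSet_avoid_and_eq (hmeas : ∀ i, Measurable (X i)) (t m : ℕ) :
    MeasurableSet
      {ω | cumulativeSum X 0 t ω + 5 = m ∧ ∀ j ≤ t, cumulativeSum X 0 j ω ∉ H} :=
  ((measurable_cumulativeSum hmeas 0 t).add_const 5 (measurableSet_singleton m)).inter
    (measurableSet_avoid hmeas 0 t)

/-- An event that depends on the first `t` rolls is independent of roll number `t + 1`. -/
theorem measure_inter_roll (hmeas : ∀ i, Measurable (X i)) (hindep : iIndepFun X μ)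
    (t m k : ℕ) :
    μ ({ω | cumulativeSum X 0 t ω + 5 = m ∧ ∀ j ≤ t, cumulativeSum X 0 j ω ∉ H} ∩ {ω | X t ω = k})
      = μ {ω | cumulativeSum X 0 t ω + 5 = m ∧ ∀ j ≤ t, cumulativeSum X 0 j ω ∉ H}
        * μ {ω | X t ω = k} := by
  have hi := hindep.indepFun_finset (Finset.range t) {t} (by simp) hmeas
  -- `part x j` recovers the sum of the first `j` rolls from the family of the first `t` rolls.
  let part : (Finset.range t → ℕ) → ℕ → ℕ := fun x j =>
    ∑ i : Finset.range t, if i.1 < j then x i else 0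
  have hpart : ∀ ω, ∀ j ≤ t,
      part (fun i => X i ω) j = cumulativeSum X 0 j ω := by
    intro ω j hj
    simp only [part, cumulativeSum, zero_add]
    rw [Finset.sum_coe_sort (Finset.range t) (fun i => if i < j then X i ω else 0),
      ← Finset.sum_filter]
    refine Finset.sum_congr ?_ fun _ _ => rfl
    ext i
    simp
    omega
  have h := hi.measure_inter_preimage_eq_mul
    {x | part x t + 5 = m ∧ ∀ j ≤ t, part x j ∉ H} {y | y ⟨t, by simp⟩ = k}
    MeasurableSet.of_discrete MeasurableSet.of_discrete
  have e : (fun (ω : Ω) (i : Finset.range t) => X i ω) ⁻¹'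
      {x | part x t + 5 = m ∧ ∀ j ≤ t, part x j ∉ H}
      = {ω | cumulativeSum X 0 t ω + 5 = m ∧ ∀ j ≤ t, cumulativeSum X 0 j ω ∉ H} := by
    ext ω
    simp only [Set.mem_preimage, Set.mem_ofPred_eq, hpart ω t le_rfl]
    refine and_congr_right fun _ => forall₂_congr fun j hj => ?_
    rw [hpart ω j hj]
  rw [e] at h
  exact h

/-- Almost surely a roll is in `{1, …, 6}`, so an event splits according to its value. -/
theorem measure_eq_sum_roll [IsProbabilityMeasure μ] (hmeas : ∀ i, Measurable (X i))
    (hunif : ∀ i, ∀ k ∈ Finset.Icc 1 6, μ {ω | X i ω = k} = 1 / 6) (t : ℕ) {B : Set Ω}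
    (hB : MeasurableSet B) :
    μ B = ∑ k ∈ Finset.Icc 1 6, μ (B ∩ {ω | X t ω = k}) := by
  have hms : ∀ k, MeasurableSet {ω | X t ω = k} := fun k =>
    hmeas t (measurableSet_singleton k)
  have hdisj : ∀ C : Set Ω, Set.PairwiseDisjoint (↑(Finset.Icc 1 6))
      fun k => C ∩ {ω | X t ω = k} := by
    intro C i _ j _ hij
    refine Set.disjoint_left.2 fun ω h1 h2 => hij ?_
    exact h1.2.symm.trans h2.2
  have hG : μ (⋃ k ∈ Finset.Icc 1 6, Set.univ ∩ {ω | X t ω = k}) = 1 := by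
    rw [measure_biUnion_finset (hdisj _) fun k _ => MeasurableSet.univ.inter (hms k)]
    simp only [Set.univ_inter]
    rw [Finset.sum_congr rfl (hunif t)]
    simp
    exact ENNReal.mul_inv_cancel (by norm_num) (by norm_num)
  rw [← measure_biUnion_finset (hdisj _) fun k _ => hB.inter (hms k)]
  have hnull := (prob_compl_eq_zero_iff (Finset.measurableSet_biUnion _ fun k _ =>
    MeasurableSet.univ.inter (hms k))).2 hG
  rw [← measure_inter_conull hnull]
  congr 1
  ext ω
  simp

/-- The one-step recurrence for the sub-probability law of the position after `t` rolls on the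
event that `H` has not been hit, shifted by `5` as in `occupation`. -/
theorem measure_avoid_succ [IsProbabilityMeasure μ] (hmeas : ∀ i, Measurable (X i))
    (hindep : iIndepFun X μ)
    (hunif : ∀ i, ∀ k ∈ Finset.Icc 1 6, μ {ω | X i ω = k} = 1 / 6) (t k : ℕ) (hk : k + 1 ∉ H) :
    μ {ω | cumulativeSum X 0 (t + 1) ω + 5 = k + 6 ∧ ∀ j ≤ t + 1, cumulativeSum X 0 j ω ∉ H}
      = ∑ i ∈ Finset.range 6,
        μ {ω | cumulativeSum X 0 t ω + 5 = k + i ∧ ∀ j ≤ t, cumulativeSum X 0 j ω ∉ H} / 6 := by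
  rw [measure_eq_sum_roll hmeas hunif t (measurableSet_avoid_and_eq hmeas _ _)]
  refine Finset.sum_bij' (fun j _ => 6 - j) (fun i _ => 6 - i) ?_ ?_ ?_ ?_ ?_
  · intro j hj; simp at hj ⊢; omega
  · intro j hj; simp at hj ⊢; omega
  · intro j hj; simp at hj ⊢; omega
  · intro j hj; simp at hj ⊢; omega
  · intro j hj
    have hj' := Finset.mem_Icc.1 hj
    rw [div_eq_mul_inv, ← one_div, ← hunif t j hj, ← measure_inter_roll hmeas hindep]
    congr 1
    ext ω
    simp only [Set.mem_inter_iff, Set.mem_ofPred_eq]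
    refine and_congr_left fun hX => ?_
    rw [cumulativeSum_succ, hX]
    refine ⟨fun ⟨h1, h2⟩ => ⟨by omega, fun i hi => h2 i (by omega)⟩, fun ⟨h1, h2⟩ =>
      ⟨by omega, fun i hi => ?_⟩⟩
    rcases Nat.lt_or_ge t i with h | h
    · obtain rfl : i = t + 1 := by omega
      rwa [cumulativeSum_succ, hX, show cumulativeSum X 0 t ω + j = k + 1 by omega]
    · exact h2 i h

/-- `occupation` is what its description says: the total probability, over all times, of being at a
position with `H` still avoided. -/
theorem tsum_measure_avoid [IsProbabilityMeasure μ] (hmeas : ∀ i, Measurable (X i))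
    (hindep : iIndepFun X μ)
    (hunif : ∀ i, ∀ k ∈ Finset.Icc 1 6, μ {ω | X i ω = k} = 1 / 6) (h0 : 0 ∉ H) (m : ℕ) :
    ∑' t, μ {ω | cumulativeSum X 0 t ω + 5 = m ∧ ∀ j ≤ t, cumulativeSum X 0 j ω ∉ H}
      = ENNReal.ofReal (occupation H m) := by
  induction m using Nat.strong_induction_on with
  | _ m ih =>
    rw [tsum_eq_zero_add' ENNReal.summable]
    match m with
    | 0 | 1 | 2 | 3 | 4 => simp [occupation]
    | 5 =>
      have : ∀ t, μ {ω | cumulativeSum X 0 (t + 1) ω + 5 = 5 ∧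
          ∀ j ≤ t + 1, cumulativeSum X 0 j ω ∉ H} = 0 := by
        intro t
        rw [measure_eq_sum_roll hmeas hunif t (measurableSet_avoid_and_eq hmeas _ _)]
        refine Finset.sum_eq_zero fun k hk => ?_
        convert measure_empty (μ := μ)
        ext ω
        have := Finset.mem_Icc.1 hk
        simp [cumulativeSum_succ]
        omega
      rw [ENNReal.tsum_eq_zero.2 this]
      simp [cumulativeSum, occupation, h0]
    | k + 6 =>
      -- Time `0` contributes only to the position `0`, that is to the index `5`.
      have hz : {ω | cumulativeSum X 0 0 ω + 5 = k + 6 ∧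
          ∀ j ≤ 0, cumulativeSum X 0 j ω ∉ H} = ∅ := by
        ext ω
        simp [cumulativeSum]
      rw [hz, measure_empty, zero_add]
      by_cases hk : k + 1 ∈ H
      · rw [occupation_of_mem hk, ENNReal.ofReal_zero, ENNReal.tsum_eq_zero]
        intro t
        convert measure_empty (μ := μ)
        ext ω
        simp only [Set.mem_ofPred_eq, Set.mem_empty_iff_false, iff_false, not_and, not_forall]
        intro h
        refine ⟨t + 1, le_rfl, ?_⟩
        have : cumulativeSum X 0 (t + 1) ω = k + 1 := by omega
        simpa [this] using hk
      · simp_rw [fun t => measure_avoid_succ hmeas hindep hunif t k hk]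
        rw [Summable.tsum_finsetSum fun _ _ => ENNReal.summable]
        have hs : ∀ i ∈ Finset.range 6, ∑' t, μ {ω | cumulativeSum X 0 t ω + 5 = k + i ∧
            ∀ j ≤ t, cumulativeSum X 0 j ω ∉ H} / 6
            = ENNReal.ofReal (occupation H (k + i) / 6) := by
          intro i hi
          simp_rw [div_eq_mul_inv]
          rw [ENNReal.tsum_mul_right, ih (k + i) (by have := Finset.mem_range.1 hi; omega),
            ← div_eq_mul_inv, ← div_eq_mul_inv, ENNReal.ofReal_div_of_pos (by norm_num)]
          simp
        rw [Finset.sum_congr rfl hs, ← ENNReal.ofReal_sum_of_nonneg fun i _ =>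
          div_nonneg (occupation_nonneg H _) (by norm_num), occupation_of_notMem hk]
        congr 1
        simp [Finset.sum_range_succ]
        ring

/-- The expected number of rolls is the expected number of positions visited before the hit. -/
theorem expectedRolls_eq_tsum_occupation [IsProbabilityMeasure μ]
    (hmeas : ∀ i, Measurable (X i)) (hindep : iIndepFun X μ)
    (hunif : ∀ i, ∀ k ∈ Finset.Icc 1 6, μ {ω | X i ω = k} = 1 / 6) (h0 : 0 ∉ H) :
    expectedRolls μ X H 0 = ∑' m, ENNReal.ofReal (occupation H m) := by
  rw [expectedRolls_eq_tsum hmeas]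
  simp_rw [← tsum_measure_avoid hmeas hindep hunif h0]
  rw [ENNReal.tsum_comm]
  refine tsum_congr fun t => ?_
  rw [← measure_iUnion]
  · congr 1
    ext ω
    simp
  · intro a b hab
    refine Set.disjoint_left.2 fun ω h1 h2 => hab ?_
    exact h1.1.symm.trans h2.1
  · intro m
    exact measurableSet_avoid_and_eq hmeas t m

end Probability

/-! ### The walk between consecutive squares -/

/-- `renewal (m + 5)` is the probability that the unstopped sum of the rolls visits `m`. -/
noncomputable def renewal : ℕ → ℝ := occupation ∅

theorem renewal_add_six (k : ℕ) :
    renewal (k + 6) = (renewal k + renewal (k + 1) + renewal (k + 2) + renewal (k + 3)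
      + renewal (k + 4) + renewal (k + 5)) / 6 :=
  occupation_of_notMem (Set.notMem_empty _)

theorem renewal_nonneg (k : ℕ) : 0 ≤ renewal k := occupation_nonneg _ k

/-- `squareOcc (m + 5)` is the probability that the sum of the rolls visits `m` before reaching a
positive square, `m` itself not being one. -/
noncomputable def squareOcc : ℕ → ℝ := occupation positiveSquares

theorem squareOcc_nonneg (k : ℕ) : 0 ≤ squareOcc k := occupation_nonneg _ k

theorem squareOcc_sq {n : ℕ} (hn : 1 ≤ n) : squareOcc (n ^ 2 + 5) = 0 := by
  obtain ⟨k, hk⟩ : ∃ k, n ^ 2 = k + 1 := Nat.exists_eq_add_one.2 (by positivity)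
  rw [hk]
  exact occupation_of_mem ⟨n, hn, hk.symm⟩

/-- The recurrence holds without interruption strictly between two squares. -/
theorem squareOcc_between {n k : ℕ} (hk : k + 1 ≤ 2 * n) :
    squareOcc (n ^ 2 + k + 6) = (squareOcc (n ^ 2 + k) + squareOcc (n ^ 2 + k + 1)
      + squareOcc (n ^ 2 + k + 2) + squareOcc (n ^ 2 + k + 3) + squareOcc (n ^ 2 + k + 4)
      + squareOcc (n ^ 2 + k + 5)) / 6 := by
  refine occupation_of_notMem ?_
  rintro ⟨j, -, hj⟩
  have h1 : n < j := lt_of_pow_lt_pow_left₀ 2 (Nat.zero_le j) (by omega)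
  have h2 : j < n + 1 := lt_of_pow_lt_pow_left₀ 2 (Nat.zero_le _) (by nlinarith)
  omega

/-- `overshoot n r` is the probability that the walk jumps over `n ^ 2` without having hit a square
and that the first position beyond `n ^ 2` is `n ^ 2 + 1 + r`. -/
noncomputable def overshoot (n r : ℕ) : ℝ := (∑ j ∈ Finset.Ico r 5, squareOcc (n ^ 2 + j)) / 6

theorem overshoot_nonneg (n r : ℕ) : 0 ≤ overshoot n r :=
  div_nonneg (Finset.sum_nonneg fun _ _ => squareOcc_nonneg _) (by norm_num)

/-- The probability that none of `1, 4, …, n ^ 2` is hit, for `1 ≤ n`. -/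
noncomputable def survival (n : ℕ) : ℝ :=
  overshoot n 0 + overshoot n 1 + overshoot n 2 + overshoot n 3 + overshoot n 4

theorem survival_nonneg (n : ℕ) : 0 ≤ survival n := by
  have := overshoot_nonneg n
  unfold survival
  linarith [this 0, this 1, this 2, this 3, this 4]

theorem overshoot_eq (n : ℕ) :
    overshoot n 0 = (squareOcc (n ^ 2) + squareOcc (n ^ 2 + 1) + squareOcc (n ^ 2 + 2)
      + squareOcc (n ^ 2 + 3) + squareOcc (n ^ 2 + 4)) / 6 ∧
    overshoot n 1 = (squareOcc (n ^ 2 + 1) + squareOcc (n ^ 2 + 2)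
      + squareOcc (n ^ 2 + 3) + squareOcc (n ^ 2 + 4)) / 6 ∧
    overshoot n 2 = (squareOcc (n ^ 2 + 2) + squareOcc (n ^ 2 + 3) + squareOcc (n ^ 2 + 4)) / 6 ∧
    overshoot n 3 = (squareOcc (n ^ 2 + 3) + squareOcc (n ^ 2 + 4)) / 6 ∧
    overshoot n 4 = squareOcc (n ^ 2 + 4) / 6 := by
  refine ⟨?_, ?_, ?_, ?_, ?_⟩ <;> simp [overshoot, Finset.sum_Ico_succ_top, Finset.sum_range_succ]

/-- Between `n ^ 2` and `(n + 1) ^ 2` the walk is a renewal process started from its overshoot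
over `n ^ 2`. -/
theorem squareOcc_eq_renewal {n : ℕ} (hn : 1 ≤ n) (k : ℕ) (hk : k + 1 ≤ 2 * n) :
    squareOcc (n ^ 2 + k + 6) = overshoot n 0 * renewal (k + 5) + overshoot n 1 * renewal (k + 4)
      + overshoot n 2 * renewal (k + 3) + overshoot n 3 * renewal (k + 2)
      + overshoot n 4 * renewal (k + 1) := by
  induction k using Nat.strong_induction_on with
  | _ k ih =>
    obtain ⟨o0, o1, o2, o3, o4⟩ := overshoot_eq n
    have hz := squareOcc_sq hn
    have r0 : renewal 0 = 0 := by simp [renewal, occupation]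
    have r1 : renewal 1 = 0 := by simp [renewal, occupation]
    have r2 : renewal 2 = 0 := by simp [renewal, occupation]
    have r3 : renewal 3 = 0 := by simp [renewal, occupation]
    have r4 : renewal 4 = 0 := by simp [renewal, occupation]
    have r5 : renewal 5 = 1 := by simp [renewal, occupation]
    have r6 := renewal_add_six 0
    have r7 := renewal_add_six 1
    have r8 := renewal_add_six 2
    have r9 := renewal_add_six 3
    have r10 := renewal_add_six 4
    norm_num [r0, r1, r2, r3, r4, r5] at r6 r7 r8 r9 r10
    rw [squareOcc_between hk]
    -- For `k ≤ 5` the recurrence still reaches back to the positions `n ^ 2 - 5, …, n ^ 2`.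
    match k with
    | 0 =>
      simp [r1, r2, r3, r4, r5, hz, o0]
    | 1 =>
      have i0 := ih 0 (by omega) (by omega)
      simp [add_assoc, r1, r2, r3, r4, r5, r6] at i0 ⊢
      linarith
    | 2 =>
      have i0 := ih 0 (by omega) (by omega)
      have i1 := ih 1 (by omega) (by omega)
      simp [add_assoc, r1, r2, r3, r4, r5, r6, r7] at i0 i1 ⊢
      linarith
    | 3 =>
      have i0 := ih 0 (by omega) (by omega)
      have i1 := ih 1 (by omega) (by omega)
      have i2 := ih 2 (by omega) (by omega)
      simp [add_assoc, r1, r2, r3, r4, r5, r6, r7, r8] at i0 i1 i2 ⊢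
      linarith
    | 4 =>
      have i0 := ih 0 (by omega) (by omega)
      have i1 := ih 1 (by omega) (by omega)
      have i2 := ih 2 (by omega) (by omega)
      have i3 := ih 3 (by omega) (by omega)
      simp [add_assoc, r1, r2, r3, r4, r5, r6, r7, r8, r9] at i0 i1 i2 i3 ⊢
      linarith
    | 5 =>
      have i0 := ih 0 (by omega) (by omega)
      have i1 := ih 1 (by omega) (by omega)
      have i2 := ih 2 (by omega) (by omega)
      have i3 := ih 3 (by omega) (by omega)
      have i4 := ih 4 (by omega) (by omega)
      simp [add_assoc, r1, r2, r3, r4, r5, r6, r7, r8, r9, r10] at i0 i1 i2 i3 i4 ⊢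
      linarith
    | k + 6 =>
      have i0 := ih k (by omega) (by omega)
      have i1 := ih (k + 1) (by omega) (by omega)
      have i2 := ih (k + 2) (by omega) (by omega)
      have i3 := ih (k + 3) (by omega) (by omega)
      have i4 := ih (k + 4) (by omega) (by omega)
      have i5 := ih (k + 5) (by omega) (by omega)
      have s1 := renewal_add_six (k + 1)
      have s2 := renewal_add_six (k + 2)
      have s3 := renewal_add_six (k + 3)
      have s4 := renewal_add_six (k + 4)
      have s5 := renewal_add_six (k + 5)
      simp only [add_assoc, Nat.reduceAdd] at i0 i1 i2 i3 i4 i5 s1 s2 s3 s4 s5 ⊢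
      linear_combination (i0 + i1 + i2 + i3 + i4 + i5) / 6 - overshoot n 0 * s5
        - overshoot n 1 * s4 - overshoot n 2 * s3 - overshoot n 3 * s2 - overshoot n 4 * s1

/-- The transfer from one square to the next. -/
theorem squareOcc_succ_sq {n : ℕ} (hn : 3 ≤ n) {j : ℕ} (hj : j ≤ 4) :
    squareOcc ((n + 1) ^ 2 + j) = overshoot n 0 * renewal (2 * n - 4 + (j + 4))
      + overshoot n 1 * renewal (2 * n - 4 + (j + 3))
      + overshoot n 2 * renewal (2 * n - 4 + (j + 2))
      + overshoot n 3 * renewal (2 * n - 4 + (j + 1)) + overshoot n 4 * renewal (2 * n - 4 + j) := by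
  have h := squareOcc_eq_renewal (by omega : 1 ≤ n) (2 * n + j - 5) (by omega)
  rw [show n ^ 2 + (2 * n + j - 5) + 6 = (n + 1) ^ 2 + j by
      rw [show (n + 1) ^ 2 = n ^ 2 + 2 * n + 1 by ring]; omega,
    show 2 * n + j - 5 + 5 = 2 * n - 4 + (j + 4) by omega,
    show 2 * n + j - 5 + 4 = 2 * n - 4 + (j + 3) by omega,
    show 2 * n + j - 5 + 3 = 2 * n - 4 + (j + 2) by omega,
    show 2 * n + j - 5 + 2 = 2 * n - 4 + (j + 1) by omega,
    show 2 * n + j - 5 + 1 = 2 * n - 4 + j by omega] at h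
  exact h

/-! ### The expected number of rolls in terms of the survival probabilities -/

/-- `crossing m` is the probability that the walk jumps from a position `≤ m` beyond `m` without
having hit a square. -/
noncomputable def crossing (m : ℕ) : ℝ :=
  (6 * squareOcc (m + 5) + 5 * squareOcc (m + 4) + 4 * squareOcc (m + 3) + 3 * squareOcc (m + 2)
    + 2 * squareOcc (m + 1) + squareOcc m) / 6

theorem crossing_sq {n : ℕ} (hn : 1 ≤ n) : crossing (n ^ 2) = survival n := by
  obtain ⟨o0, o1, o2, o3, o4⟩ := overshoot_eq n
  rw [crossing, survival, squareOcc_sq hn, o0, o1, o2, o3, o4]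
  ring

/-- No mass is lost strictly between two squares. -/
theorem crossing_between {n k : ℕ} (hn : 1 ≤ n) (hk : k ≤ 2 * n) :
    crossing (n ^ 2 + k) = survival n := by
  induction k with
  | zero => exact crossing_sq hn
  | succ k ih =>
    rw [← ih (by omega), crossing, crossing]
    have := squareOcc_between hk
    simp only [add_assoc, add_comm 1, Nat.reduceAdd] at this ⊢
    linarith

/-- The expected overshoot of the walk over `m` on the event that no square `≤ m` is hit. -/
noncomputable def meanOvershoot (m : ℕ) : ℝ :=
  (21 * squareOcc (m + 5) + 15 * squareOcc (m + 4) + 10 * squareOcc (m + 3)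
    + 6 * squareOcc (m + 2) + 3 * squareOcc (m + 1) + squareOcc m) / 6

theorem meanOvershoot_succ (m : ℕ) :
    meanOvershoot (m + 1) = meanOvershoot m - crossing m + 7 / 2 * squareOcc (m + 6) := by
  simp only [meanOvershoot, crossing, add_assoc, Nat.reduceAdd]
  ring

/-- Wald's identity, in telescoped form: `7 / 2` is the mean of a roll, and each level `m` that is
crossed contributes `1` to the distance covered. -/
theorem sum_squareOcc (m : ℕ) :
    7 / 2 * ∑ j ∈ Finset.range (m + 6), squareOcc j
      = meanOvershoot m + ∑ j ∈ Finset.range m, crossing j := by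
  induction m with
  | zero => simp [Finset.sum_range_succ, meanOvershoot, squareOcc, occupation]; norm_num
  | succ m ih =>
    rw [show m + 1 + 6 = (m + 6) + 1 by ring, Finset.sum_range_succ _ (m + 6),
      Finset.sum_range_succ _ m, mul_add, ih, meanOvershoot_succ]
    ring

/-- Both sides are weighted sums of the same five values, as `squareOcc` vanishes at the square, and
the weights satisfy `15 ≤ 3 * 5, 10 ≤ 3 * 4, 6 ≤ 3 * 3, …`. -/
theorem meanOvershoot_sq_le {n : ℕ} (hn : 1 ≤ n) : meanOvershoot (n ^ 2) ≤ 3 * survival n := by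
  have h := squareOcc_nonneg
  rw [← crossing_sq hn, meanOvershoot, crossing, squareOcc_sq hn]
  linarith [h (n ^ 2), h (n ^ 2 + 1), h (n ^ 2 + 2), h (n ^ 2 + 3), h (n ^ 2 + 4)]

theorem meanOvershoot_nonneg (m : ℕ) : 0 ≤ meanOvershoot m := by
  have h := squareOcc_nonneg
  rw [meanOvershoot]
  linarith [h m, h (m + 1), h (m + 2), h (m + 3), h (m + 4), h (m + 5)]

theorem sum_crossing {n : ℕ} (hn : 1 ≤ n) :
    ∑ j ∈ Finset.range (n ^ 2), crossing j
      = 1 + ∑ k ∈ Finset.Ico 1 n, (2 * k + 1) * survival k := by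
  induction n, hn using Nat.le_induction with
  | base => simp [crossing, squareOcc, occupation]
  | succ n hn ih =>
    rw [show (n + 1) ^ 2 = n ^ 2 + (2 * n + 1) by ring, Finset.sum_range_add, ih,
      Finset.sum_Ico_succ_top hn, Finset.sum_congr rfl fun k hk =>
        crossing_between hn (Nat.lt_succ_iff.1 (Finset.mem_range.1 hk))]
    simp
    ring

/-! ### The tail of the series -/

/-- A renewal probability is the average of the preceding six, so six consecutive values in an
interval keep all later ones there. -/
theorem renewal_mem_Icc {a b : ℝ} {m : ℕ} (h0 : renewal m ∈ Set.Icc a b)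
    (h1 : renewal (m + 1) ∈ Set.Icc a b) (h2 : renewal (m + 2) ∈ Set.Icc a b)
    (h3 : renewal (m + 3) ∈ Set.Icc a b) (h4 : renewal (m + 4) ∈ Set.Icc a b)
    (h5 : renewal (m + 5) ∈ Set.Icc a b) {k : ℕ} (hk : m ≤ k) : renewal k ∈ Set.Icc a b := by
  obtain ⟨k, rfl⟩ := Nat.exists_eq_add_of_le hk
  clear hk
  induction k using Nat.strong_induction_on with
  | _ k ih =>
    match k with
    | 0 => exact h0
    | 1 => exact h1
    | 2 => exact h2
    | 3 => exact h3
    | 4 => exact h4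
    | 5 => exact h5
    | k + 6 =>
      have i0 := ih k (by omega)
      have i1 := ih (k + 1) (by omega)
      have i2 := ih (k + 2) (by omega)
      have i3 := ih (k + 3) (by omega)
      have i4 := ih (k + 4) (by omega)
      have i5 := ih (k + 5) (by omega)
      have e := renewal_add_six (m + k)
      simp only [Set.mem_Icc, ← add_assoc] at *
      constructor <;> linarith

theorem survival_eq (n : ℕ) :
    survival n = (squareOcc (n ^ 2) + 2 * squareOcc (n ^ 2 + 1) + 3 * squareOcc (n ^ 2 + 2)
      + 4 * squareOcc (n ^ 2 + 3) + 5 * squareOcc (n ^ 2 + 4)) / 6 := by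
  obtain ⟨o0, o1, o2, o3, o4⟩ := overshoot_eq n
  rw [survival, o0, o1, o2, o3, o4]
  ring

/-- If the renewal probabilities have settled in `[a, b]` before `(n + 1) ^ 2`, then each of the
five positions before `(n + 1) ^ 2` is visited with probability between `a` and `b` times
`survival n`. The weights `1, …, 5` of these positions, divided by `6`, add up to `5 / 2`. -/
theorem survival_succ_mem_Icc {a b : ℝ} {n : ℕ} (hn : 3 ≤ n)
    (h : ∀ k, 2 * n - 4 ≤ k → renewal k ∈ Set.Icc a b) :
    survival (n + 1) ∈ Set.Icc (5 / 2 * a * survival n) (5 / 2 * b * survival n) := by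
  have key : ∀ j ≤ 4,
      squareOcc ((n + 1) ^ 2 + j) ∈ Set.Icc (a * survival n) (b * survival n) := by
    intro j hj
    have o := overshoot_nonneg n
    have h0 := h (2 * n - 4 + (j + 4)) (by omega)
    have h1 := h (2 * n - 4 + (j + 3)) (by omega)
    have h2 := h (2 * n - 4 + (j + 2)) (by omega)
    have h3 := h (2 * n - 4 + (j + 1)) (by omega)
    have h4 := h (2 * n - 4 + j) (by omega)
    rw [squareOcc_succ_sq hn hj, survival]
    constructor
    · linarith [mul_le_mul_of_nonneg_left h0.1 (o 0), mul_le_mul_of_nonneg_left h1.1 (o 1),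
        mul_le_mul_of_nonneg_left h2.1 (o 2), mul_le_mul_of_nonneg_left h3.1 (o 3),
        mul_le_mul_of_nonneg_left h4.1 (o 4)]
    · linarith [mul_le_mul_of_nonneg_left h0.2 (o 0), mul_le_mul_of_nonneg_left h1.2 (o 1),
        mul_le_mul_of_nonneg_left h2.2 (o 2), mul_le_mul_of_nonneg_left h3.2 (o 3),
        mul_le_mul_of_nonneg_left h4.2 (o 4)]
  have k0 := key 0 (by norm_num)
  have k1 := key 1 (by norm_num)
  have k2 := key 2 (by norm_num)
  have k3 := key 3 (by norm_num)
  have k4 := key 4 (by norm_num)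
  rw [survival_eq (n + 1)]
  simp only [Set.mem_Icc, add_zero] at *
  constructor <;> linarith

/-- `levelSum n` is the expected number of levels `m < n ^ 2` crossed before a square is hit: there
are `2 * k + 1` levels in `[k ^ 2, (k + 1) ^ 2)`, and the one level below `1` is always crossed. -/
noncomputable def levelSum (n : ℕ) : ℝ := 1 + ∑ k ∈ Finset.Ico 1 n, (2 * k + 1) * survival k

theorem levelSum_succ {n : ℕ} (hn : 1 ≤ n) :
    levelSum (n + 1) = levelSum n + (2 * n + 1) * survival n := by
  rw [levelSum, levelSum, Finset.sum_Ico_succ_top hn, add_assoc]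

section Tail

variable {η : ℝ} {N : ℕ}

/-- With exact decay rate `5 / 7` the quantity `levelSum n + (7 * n + 21) * survival n` is constant.
For a rate that is off by a relative error `η / 2`, inflating the tail by `10 * η` makes it
decrease. -/
theorem levelSum_add_tail_upper_antitone (hη : 0 ≤ η) (hη' : η ≤ 1 / 10) {n : ℕ} (hn : 1 ≤ n)
    (h : survival (n + 1) ≤ 5 / 2 * ((2 + η) / 7) * survival n) :
    levelSum (n + 1) + (1 + 10 * η) * (7 * (n + 1 : ℕ) + 21) * survival (n + 1)
      ≤ levelSum n + (1 + 10 * η) * (7 * n + 21) * survival n := by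
  rw [levelSum_succ hn]
  have hR := survival_nonneg n
  have hn' : (1 : ℝ) ≤ n := by exact_mod_cast hn
  have h1 : (1 + 10 * η) * (7 * (n + 1 : ℕ) + 21) * survival (n + 1)
      ≤ (1 + 10 * η) * (7 * (n + 1 : ℕ) + 21) * (5 / 2 * ((2 + η) / 7) * survival n) :=
    mul_le_mul_of_nonneg_left h (by positivity)
  have h2 : 2 * n + 1 + (1 + 10 * η) * (7 * (n + 1 : ℕ) + 21) * (5 / 2 * ((2 + η) / 7))
      ≤ (1 + 10 * η) * (7 * n + 21) := by
    push_cast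
    nlinarith [mul_nonneg hη (sub_nonneg.2 hη'), mul_nonneg hη (sub_nonneg.2 hn'),
      mul_nonneg (mul_nonneg hη (sub_nonneg.2 hη')) (sub_nonneg.2 hn')]
  nlinarith [mul_le_mul_of_nonneg_right h2 hR]

/-- The counterpart of `levelSum_add_tail_upper_antitone`: deflating the tail by `10 * η` makes the
quantity increase. -/
theorem levelSum_add_tail_lower_monotone (hη : 0 ≤ η) (hη' : η ≤ 1 / 10) {n : ℕ} (hn : 1 ≤ n)
    (h : 5 / 2 * ((2 - η) / 7) * survival n ≤ survival (n + 1)) :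
    levelSum n + (1 - 10 * η) * (7 * n + 21) * survival n
      ≤ levelSum (n + 1) + (1 - 10 * η) * (7 * (n + 1 : ℕ) + 21) * survival (n + 1) := by
  rw [levelSum_succ hn]
  have hR := survival_nonneg n
  have hn' : (1 : ℝ) ≤ n := by exact_mod_cast hn
  have h1 : (1 - 10 * η) * (7 * (n + 1 : ℕ) + 21) * (5 / 2 * ((2 - η) / 7) * survival n)
      ≤ (1 - 10 * η) * (7 * (n + 1 : ℕ) + 21) * survival (n + 1) :=
    mul_le_mul_of_nonneg_left h (mul_nonneg (by linarith) (by positivity))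
  have h2 : (1 - 10 * η) * (7 * n + 21)
      ≤ 2 * n + 1 + (1 - 10 * η) * (7 * (n + 1 : ℕ) + 21) * (5 / 2 * ((2 - η) / 7)) := by
    push_cast
    nlinarith [mul_nonneg hη (sub_nonneg.2 hη'), mul_nonneg hη (sub_nonneg.2 hn'),
      mul_nonneg (mul_nonneg hη (sub_nonneg.2 hη')) (sub_nonneg.2 hn')]
  nlinarith [mul_le_mul_of_nonneg_right h2 hR]

theorem sum_squareOcc_sq {n : ℕ} (hn : 1 ≤ n) :
    7 / 2 * ∑ j ∈ Finset.range (n ^ 2 + 6), squareOcc j = meanOvershoot (n ^ 2) + levelSum n := by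
  rw [sum_squareOcc, sum_crossing hn, levelSum]

/-- Enclosure of the whole series, from the first `N` survival probabilities and the deviation
`η / 7` of the renewal probabilities from `2 / 7`. -/
theorem summable_squareOcc_and_bounds (hη : 0 ≤ η) (hη' : η ≤ 1 / 10) (hN : 3 ≤ N)
    (h : ∀ k, 2 * N - 4 ≤ k → renewal k ∈ Set.Icc ((2 - η) / 7) ((2 + η) / 7)) :
    Summable squareOcc ∧
    levelSum N + (1 - 10 * η) * (7 * N + 21) * survival N ≤ 7 / 2 * ∑' m, squareOcc m ∧
    7 / 2 * ∑' m, squareOcc m ≤ levelSum N + (1 + 10 * η) * (7 * N + 21) * survival N := by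
  have hR := survival_nonneg
  have hstep : ∀ n, N ≤ n → survival (n + 1) ∈
      Set.Icc (5 / 2 * ((2 - η) / 7) * survival n) (5 / 2 * ((2 + η) / 7) * survival n) :=
    fun n hn => survival_succ_mem_Icc (by omega) fun k hk => h k (by omega)
  -- `B` bounds all partial sums, as the inflated tail absorbs the boundary term `meanOvershoot`.
  set B := levelSum N + (1 + 10 * η) * (7 * N + 21) * survival N with hB
  have hup : ∀ n, N ≤ n → levelSum n + (1 + 10 * η) * (7 * n + 21) * survival n ≤ B := by
    intro n hn
    induction n, hn using Nat.le_induction with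
    | base => exact le_rfl
    | succ n hn ih =>
      exact (levelSum_add_tail_upper_antitone hη hη' (by omega) (hstep n hn).2).trans ih
  have hlow : ∀ n, N ≤ n → levelSum N + (1 - 10 * η) * (7 * N + 21) * survival N
      ≤ levelSum n + (1 - 10 * η) * (7 * n + 21) * survival n := by
    intro n hn
    induction n, hn using Nat.le_induction with
    | base => exact le_rfl
    | succ n hn ih =>
      exact ih.trans (levelSum_add_tail_lower_monotone hη hη' (by omega) (hstep n hn).1)
  have hpart : ∀ m, ∑ j ∈ Finset.range m, squareOcc j ≤ 2 / 7 * B := by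
    intro m
    have hm : m ≤ (max N m) ^ 2 + 6 :=
      (le_max_right N m).trans ((Nat.le_self_pow two_ne_zero _).trans (Nat.le_add_right _ _))
    have h1 : ∑ j ∈ Finset.range m, squareOcc j
        ≤ ∑ j ∈ Finset.range ((max N m) ^ 2 + 6), squareOcc j :=
      Finset.sum_le_sum_of_subset_of_nonneg (Finset.range_subset_range.2 hm)
        fun j _ _ => squareOcc_nonneg j
    have h1' : 1 ≤ max N m := le_max_of_le_left (by omega)
    have h2 := sum_squareOcc_sq h1'
    have h3 := meanOvershoot_sq_le h1'
    have h4 := hup (max N m) (le_max_left _ _)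
    have h5 : 3 * survival (max N m)
        ≤ (1 + 10 * η) * (7 * (max N m : ℕ) + 21) * survival (max N m) := by
      refine mul_le_mul_of_nonneg_right ?_ (hR _)
      have : (0 : ℝ) ≤ (max N m : ℕ) := Nat.cast_nonneg _
      nlinarith [mul_nonneg hη this]
    linarith
  have hs : Summable squareOcc := summable_of_sum_range_le squareOcc_nonneg hpart
  refine ⟨hs, ?_, ?_⟩
  · have hle : ∀ n, 1 ≤ n → levelSum n ≤ 7 / 2 * ∑' m, squareOcc m := by
      intro n hn
      have h1 := hs.sum_le_tsum (Finset.range (n ^ 2 + 6)) fun j _ => squareOcc_nonneg j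
      have h2 := sum_squareOcc_sq hn
      have h3 := meanOvershoot_nonneg (n ^ 2)
      linarith
    have hsum : Summable fun k : ℕ => (2 * (1 + k : ℕ) + 1) * survival (1 + k) := by
      refine summable_of_sum_range_le (c := 7 / 2 * ∑' m, squareOcc m)
        (fun k => mul_nonneg (by positivity) (hR _)) fun n => ?_
      have h1 := hle (n + 1) (by omega)
      rw [levelSum, Finset.sum_Ico_eq_sum_range, Nat.add_sub_cancel] at h1
      linarith
    -- The deflated tail at `n` is at most `10` times a term of a convergent series, so it vanishes
    -- in the limit.
    have hlim : Filter.Tendsto (fun n : ℕ => 7 / 2 * ∑' m, squareOcc m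
        + 10 * ((2 * (1 + n : ℕ) + 1) * survival (1 + n))) Filter.atTop
        (nhds (7 / 2 * ∑' m, squareOcc m + 10 * 0)) :=
      tendsto_const_nhds.add (hsum.tendsto_atTop_zero.const_mul 10)
    rw [mul_zero, add_zero] at hlim
    refine ge_of_tendsto hlim (Filter.eventually_atTop.2 ⟨N, fun n hn => ?_⟩)
    refine (hlow (1 + n) (by omega)).trans (add_le_add (hle _ (by omega)) ?_)
    rw [← mul_assoc]
    refine mul_le_mul_of_nonneg_right ?_ (hR _)
    push_cast
    nlinarith [mul_nonneg hη (Nat.cast_nonneg (α := ℝ) n)]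
  · have := hs.tsum_le_of_sum_range_le hpart
    linarith

end Tail

/-! ### Fixed-point evaluation of the survival probabilities -/

/-- `strict n f` is `f n`, written so that the kernel evaluates `n` to a numeral before substituting
it into `f`. -/
def strict {α : Type*} (n : ℕ) (f : ℕ → α) : α :=
  Nat.rec (f 0) (fun m _ => f m.succ) n

theorem strict_eq {α : Type*} (n : ℕ) (f : ℕ → α) : strict n f = f n := by
  cases n <;> rfl

/-- Fixed-point data at the square `n ^ 2`, in units of `1 / K` for a scale `K`: `xj` approximates
`squareOcc (n ^ 2 + j)` and `vj` approximates `renewal (2 * n - 4 + j)`, while `acc` approximates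
`6 * (levelSum n - levelSum 3)`. -/
structure FixedState where
  n : ℕ
  acc : ℕ
  x0 : ℕ
  x1 : ℕ
  x2 : ℕ
  x3 : ℕ
  x4 : ℕ
  v0 : ℕ
  v1 : ℕ
  v2 : ℕ
  v3 : ℕ
  v4 : ℕ
  v5 : ℕ
  v6 : ℕ
  v7 : ℕ
  v8 : ℕ

namespace FixedState

/-- Advance the data from `n` to `n + 1`. Here `br` is six times the approximation to
`overshoot n r`. Quotients are rounded down for `d = 0`, and to a strict upper bound for `d = 1`. -/
def step (d K : ℕ) (s : FixedState) : FixedState :=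
  strict (s.n + 1) fun n =>
  strict s.x4 fun b4 =>
  strict (b4 + s.x3) fun b3 =>
  strict (b3 + s.x2) fun b2 =>
  strict (b2 + s.x1) fun b1 =>
  strict (b1 + s.x0) fun b0 =>
  strict (s.acc + (2 * s.n + 1) * (b0 + b1 + b2 + b3 + b4)) fun acc =>
  strict ((b0 * s.v4 + b1 * s.v3 + b2 * s.v2 + b3 * s.v1 + b4 * s.v0) / (6 * K) + d) fun x0 =>
  strict ((b0 * s.v5 + b1 * s.v4 + b2 * s.v3 + b3 * s.v2 + b4 * s.v1) / (6 * K) + d) fun x1 =>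
  strict ((b0 * s.v6 + b1 * s.v5 + b2 * s.v4 + b3 * s.v3 + b4 * s.v2) / (6 * K) + d) fun x2 =>
  strict ((b0 * s.v7 + b1 * s.v6 + b2 * s.v5 + b3 * s.v4 + b4 * s.v3) / (6 * K) + d) fun x3 =>
  strict ((b0 * s.v8 + b1 * s.v7 + b2 * s.v6 + b3 * s.v5 + b4 * s.v4) / (6 * K) + d) fun x4 =>
  strict ((s.v3 + s.v4 + s.v5 + s.v6 + s.v7 + s.v8) / 6 + d) fun v9 =>
  strict ((s.v4 + s.v5 + s.v6 + s.v7 + s.v8 + v9) / 6 + d) fun v10 =>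
  ⟨n, acc, x0, x1, x2, x3, x4, s.v2, s.v3, s.v4, s.v5, s.v6, s.v7, s.v8, v9, v10⟩

/-- `2 ^ k` steps. The `match` makes the kernel finish the first half of the steps before it starts
on the second, so that the depth of the evaluation grows with `k` only. -/
def iter (d K : ℕ) : ℕ → FixedState → FixedState
  | 0, s => s.step d K
  | k + 1, s =>
    match iter d K k s with
    | ⟨n, acc, x0, x1, x2, x3, x4, v0, v1, v2, v3, v4, v5, v6, v7, v8⟩ =>
      iter d K k ⟨n, acc, x0, x1, x2, x3, x4, v0, v1, v2, v3, v4, v5, v6, v7, v8⟩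

/-- The data at `n = 3`. -/
def initial (d K : ℕ) : FixedState :=
  ⟨3, 0, 0, 49 * K / 216 + d, 343 * K / 1296 + d, 1105 * K / 7776 + d, 7735 * K / 46656 + d,
    0, 0, 0, K, K / 6 + d, 7 * K / 36 + d, 49 * K / 216 + d, 343 * K / 1296 + d,
    2401 * K / 7776 + d⟩

end FixedState

/-- A direction of rounding: `r a b` says that the natural number `a` bounds the nonnegative real
`b` on a fixed side, and `d` is what has to be added to a floor quotient to stay on that side. The
two instances are lower bounds with `d = 0` and upper bounds with `d = 1`. -/
structure IsRounding (r : ℕ → ℝ → Prop) (d : ℕ) : Prop where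
  natCast : ∀ a : ℕ, r a a
  add : ∀ {a a' : ℕ} {b b' : ℝ}, r a b → r a' b' → r (a + a') (b + b')
  mul : ∀ {a a' : ℕ} {b b' : ℝ}, 0 ≤ b → 0 ≤ b' → r a b → r a' b' → r (a * a') (b * b')
  div : ∀ {a q : ℕ} {b : ℝ}, 0 < q → r a b → r (a / q + d) (b / q)

theorem isRounding_lower : IsRounding (fun a b => (a : ℝ) ≤ b) 0 where
  natCast a := le_rfl
  add h h' := by push_cast; exact add_le_add h h'
  mul hb _ h h' := by push_cast; exact mul_le_mul h h' (Nat.cast_nonneg _) hb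
  div hq h := by
    rw [add_zero]
    exact Nat.cast_div_le.trans (div_le_div_of_nonneg_right h (Nat.cast_nonneg _))

theorem isRounding_upper : IsRounding (fun a b => b ≤ (a : ℝ)) 1 where
  natCast a := le_rfl
  add h h' := by push_cast; exact add_le_add h h'
  mul _ hb h h' := by push_cast; exact mul_le_mul h h' hb (Nat.cast_nonneg _)
  div {a q b} hq h := by
    have hq' : (0 : ℝ) < q := by exact_mod_cast hq
    rw [div_le_iff₀ hq']
    refine h.trans ?_
    exact_mod_cast (Nat.lt_div_mul_add hq (a := a)).le.trans (by rw [add_mul, one_mul])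

/-- The data `s` at `n` bound the exact quantities on the side of `r`. -/
structure Encloses (r : ℕ → ℝ → Prop) (K n : ℕ) (s : FixedState) : Prop where
  n_eq : s.n = n
  acc : r s.acc (6 * K * (levelSum n - levelSum 3))
  x0 : r s.x0 (K * squareOcc (n ^ 2 + 0))
  x1 : r s.x1 (K * squareOcc (n ^ 2 + 1))
  x2 : r s.x2 (K * squareOcc (n ^ 2 + 2))
  x3 : r s.x3 (K * squareOcc (n ^ 2 + 3))
  x4 : r s.x4 (K * squareOcc (n ^ 2 + 4))
  v0 : r s.v0 (K * renewal (2 * n - 4 + 0))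
  v1 : r s.v1 (K * renewal (2 * n - 4 + 1))
  v2 : r s.v2 (K * renewal (2 * n - 4 + 2))
  v3 : r s.v3 (K * renewal (2 * n - 4 + 3))
  v4 : r s.v4 (K * renewal (2 * n - 4 + 4))
  v5 : r s.v5 (K * renewal (2 * n - 4 + 5))
  v6 : r s.v6 (K * renewal (2 * n - 4 + 6))
  v7 : r s.v7 (K * renewal (2 * n - 4 + 7))
  v8 : r s.v8 (K * renewal (2 * n - 4 + 8))

section Encloses

variable {r : ℕ → ℝ → Prop} {d K n : ℕ} {s : FixedState}

/-- The rounded form of the transfer from `n ^ 2` to `(n + 1) ^ 2`. -/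
theorem IsRounding.transfer (hr : IsRounding r d) (hK : 0 < K) (hn : 3 ≤ n) {j : ℕ} (hj : j ≤ 4)
    {b0 b1 b2 b3 b4 w0 w1 w2 w3 w4 : ℕ}
    (h0 : r b0 (6 * K * overshoot n 0)) (h1 : r b1 (6 * K * overshoot n 1))
    (h2 : r b2 (6 * K * overshoot n 2)) (h3 : r b3 (6 * K * overshoot n 3))
    (h4 : r b4 (6 * K * overshoot n 4))
    (u0 : r w0 (K * renewal (2 * n - 4 + (j + 4)))) (u1 : r w1 (K * renewal (2 * n - 4 + (j + 3))))
    (u2 : r w2 (K * renewal (2 * n - 4 + (j + 2)))) (u3 : r w3 (K * renewal (2 * n - 4 + (j + 1))))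
    (u4 : r w4 (K * renewal (2 * n - 4 + j))) :
    r ((b0 * w0 + b1 * w1 + b2 * w2 + b3 * w3 + b4 * w4) / (6 * K) + d)
      (K * squareOcc ((n + 1) ^ 2 + j)) := by
  have hb : ∀ i, 0 ≤ 6 * K * overshoot n i := fun i =>
    mul_nonneg (by positivity) (overshoot_nonneg n i)
  have hw : ∀ i, 0 ≤ K * renewal i := fun i => mul_nonneg (by positivity) (renewal_nonneg i)
  have h := hr.div (q := 6 * K) (by omega)
    (hr.add (hr.add (hr.add (hr.add (hr.mul (hb _) (hw _) h0 u0) (hr.mul (hb _) (hw _) h1 u1))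
      (hr.mul (hb _) (hw _) h2 u2)) (hr.mul (hb _) (hw _) h3 u3)) (hr.mul (hb _) (hw _) h4 u4))
  convert h using 1
  rw [squareOcc_succ_sq hn hj]
  have : (K : ℝ) ≠ 0 := by exact_mod_cast hK.ne'
  push_cast
  field_simp

theorem IsRounding.average (hr : IsRounding r d) (m : ℕ) {w0 w1 w2 w3 w4 w5 : ℕ}
    (h0 : r w0 (K * renewal m)) (h1 : r w1 (K * renewal (m + 1)))
    (h2 : r w2 (K * renewal (m + 2))) (h3 : r w3 (K * renewal (m + 3)))
    (h4 : r w4 (K * renewal (m + 4))) (h5 : r w5 (K * renewal (m + 5))) :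
    r ((w0 + w1 + w2 + w3 + w4 + w5) / 6 + d) (K * renewal (m + 6)) := by
  have h := hr.div (q := 6) (by norm_num)
    (hr.add (hr.add (hr.add (hr.add (hr.add h0 h1) h2) h3) h4) h5)
  convert h using 1
  rw [renewal_add_six]
  push_cast
  ring

theorem Encloses.step (hr : IsRounding r d) (hK : 0 < K) (hn : 3 ≤ n) (h : Encloses r K n s) :
    Encloses r K (n + 1) (s.step d K) := by
  obtain ⟨o0, o1, o2, o3, o4⟩ := overshoot_eq n
  have b4 : r s.x4 (6 * K * overshoot n 4) := by
    convert h.x4 using 1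
    rw [o4]; ring
  have b3 : r (s.x4 + s.x3) (6 * K * overshoot n 3) := by
    convert hr.add b4 h.x3 using 1
    rw [o3, o4]; ring
  have b2 : r (s.x4 + s.x3 + s.x2) (6 * K * overshoot n 2) := by
    convert hr.add b3 h.x2 using 1
    rw [o2, o3]; ring
  have b1 : r (s.x4 + s.x3 + s.x2 + s.x1) (6 * K * overshoot n 1) := by
    convert hr.add b2 h.x1 using 1
    rw [o1, o2]; ring
  have b0 : r (s.x4 + s.x3 + s.x2 + s.x1 + s.x0) (6 * K * overshoot n 0) := by
    convert hr.add b1 h.x0 using 1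
    rw [o0, o1, add_zero]; ring
  have e : 2 * (n + 1) - 4 = 2 * n - 4 + 2 := by omega
  have v9 := hr.average (2 * n - 4 + 3) h.v3 h.v4 h.v5 h.v6 h.v7 h.v8
  have v10 := hr.average (2 * n - 4 + 4) h.v4 h.v5 h.v6 h.v7 h.v8 v9
  simp only [FixedState.step, strict_eq]
  constructor
  case n_eq => simp [h.n_eq]
  case acc =>
    have hsum := hr.mul (b := ((2 * n + 1 : ℕ) : ℝ)) (b' := 6 * K * survival n) (by positivity)
      (mul_nonneg (by positivity) (survival_nonneg n)) (hr.natCast _)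
      (by
        convert hr.add (hr.add (hr.add (hr.add b0 b1) b2) b3) b4 using 1
        rw [survival]; ring)
    convert hr.add h.acc hsum using 1
    · simp only [h.n_eq]
    · rw [levelSum_succ (by omega)]
      push_cast
      ring
  case x0 =>
    exact hr.transfer hK hn (j := 0) (by norm_num) b0 b1 b2 b3 b4 h.v4 h.v3 h.v2 h.v1 h.v0
  case x1 =>
    exact hr.transfer hK hn (j := 1) (by norm_num) b0 b1 b2 b3 b4 h.v5 h.v4 h.v3 h.v2 h.v1
  case x2 =>
    exact hr.transfer hK hn (j := 2) (by norm_num) b0 b1 b2 b3 b4 h.v6 h.v5 h.v4 h.v3 h.v2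
  case x3 =>
    exact hr.transfer hK hn (j := 3) (by norm_num) b0 b1 b2 b3 b4 h.v7 h.v6 h.v5 h.v4 h.v3
  case x4 =>
    exact hr.transfer hK hn (j := 4) (by norm_num) b0 b1 b2 b3 b4 h.v8 h.v7 h.v6 h.v5 h.v4
  case v0 => rw [e]; exact h.v2
  case v1 => rw [e]; exact h.v3
  case v2 => rw [e]; exact h.v4
  case v3 => rw [e]; exact h.v5
  case v4 => rw [e]; exact h.v6
  case v5 => rw [e]; exact h.v7
  case v6 => rw [e]; exact h.v8
  case v7 => rw [e]; exact v9
  case v8 => rw [e]; exact v10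

theorem Encloses.iter (hr : IsRounding r d) (hK : 0 < K) (k : ℕ) (hn : 3 ≤ n)
    (h : Encloses r K n s) : Encloses r K (n + 2 ^ k) (s.iter d K k) := by
  induction k generalizing n s with
  | zero => exact h.step hr hK hn
  | succ k ih =>
    rw [pow_succ, mul_two, ← add_assoc]
    exact ih (hn.trans (Nat.le_add_right _ _)) (ih hn h)

/-- The walk up to position `8`, from which the computation starts. -/
theorem squareOcc_initial :
    squareOcc 9 = 0 ∧ squareOcc 10 = 49 / 216 ∧ squareOcc 11 = 343 / 1296
      ∧ squareOcc 12 = 1105 / 7776 ∧ squareOcc 13 = 7735 / 46656 ∧ levelSum 3 = 1411 / 216 := by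
  have a1 : squareOcc 1 = 0 := by simp [squareOcc, occupation]
  have a2 : squareOcc 2 = 0 := by simp [squareOcc, occupation]
  have a3 : squareOcc 3 = 0 := by simp [squareOcc, occupation]
  have a4 : squareOcc 4 = 0 := by simp [squareOcc, occupation]
  have a5 : squareOcc 5 = 1 := by simp [squareOcc, occupation]
  have a6 : squareOcc 6 = 0 := squareOcc_sq (n := 1) le_rfl
  have a7 := squareOcc_between (n := 1) (k := 0) (by norm_num)
  have a8 := squareOcc_between (n := 1) (k := 1) (by norm_num)
  have a9 : squareOcc 9 = 0 := squareOcc_sq (n := 2) (by norm_num)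
  have a10 := squareOcc_between (n := 2) (k := 0) (by norm_num)
  have a11 := squareOcc_between (n := 2) (k := 1) (by norm_num)
  have a12 := squareOcc_between (n := 2) (k := 2) (by norm_num)
  have a13 := squareOcc_between (n := 2) (k := 3) (by norm_num)
  norm_num [a1, a2, a3, a4, a5, a6] at a7
  norm_num [a2, a3, a4, a5, a6, a7] at a8
  norm_num [a4, a5, a6, a7, a8, a9] at a10
  norm_num [a5, a6, a7, a8, a9, a10] at a11
  norm_num [a6, a7, a8, a9, a10, a11] at a12
  norm_num [a7, a8, a9, a10, a11, a12] at a13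
  refine ⟨a9, a10, a11, a12, a13, ?_⟩
  norm_num [levelSum, Finset.sum_Ico_succ_top, survival_eq, a1, a2, a3, a4, a5, a6, a7, a8]

theorem renewal_initial :
    renewal 2 = 0 ∧ renewal 3 = 0 ∧ renewal 4 = 0 ∧ renewal 5 = 1 ∧ renewal 6 = 1 / 6
      ∧ renewal 7 = 7 / 36 ∧ renewal 8 = 49 / 216 ∧ renewal 9 = 343 / 1296
      ∧ renewal 10 = 2401 / 7776 := by
  have r0 : renewal 0 = 0 := by simp [renewal, occupation]
  have r1 : renewal 1 = 0 := by simp [renewal, occupation]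
  have r2 : renewal 2 = 0 := by simp [renewal, occupation]
  have r3 : renewal 3 = 0 := by simp [renewal, occupation]
  have r4 : renewal 4 = 0 := by simp [renewal, occupation]
  have r5 : renewal 5 = 1 := by simp [renewal, occupation]
  have r6 := renewal_add_six 0
  have r7 := renewal_add_six 1
  have r8 := renewal_add_six 2
  have r9 := renewal_add_six 3
  have r10 := renewal_add_six 4
  norm_num [r0, r1, r2, r3, r4, r5] at r6
  norm_num [r1, r2, r3, r4, r5, r6] at r7
  norm_num [r2, r3, r4, r5, r6, r7] at r8
  norm_num [r3, r4, r5, r6, r7, r8] at r9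
  norm_num [r4, r5, r6, r7, r8, r9] at r10
  exact ⟨r2, r3, r4, r5, r6, r7, r8, r9, r10⟩

theorem encloses_initial (hr : IsRounding r d) (K : ℕ) :
    Encloses r K 3 (FixedState.initial d K) := by
  obtain ⟨a9, a10, a11, a12, a13, -⟩ := squareOcc_initial
  obtain ⟨r2, r3, r4, r5, r6, r7, r8, r9, r10⟩ := renewal_initial
  have hz : r 0 0 := by simpa using hr.natCast 0
  have hone := hr.natCast K
  have hq : ∀ (p q : ℕ), 0 < q → r (p * K / q + d) (K * (p / q)) := by
    intro p q hq
    convert hr.div hq (hr.natCast (p * K)) using 1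
    push_cast
    ring
  simp only [FixedState.initial]
  constructor <;>
    norm_num only [a9, a10, a11, a12, a13, r2, r3, r4, r5, r6, r7, r8, r9, r10, sub_self, mul_zero,
      mul_one]
  exacts [hz, hz, mod_cast hq 49 216 (by norm_num), mod_cast hq 343 1296 (by norm_num),
    mod_cast hq 1105 7776 (by norm_num), mod_cast hq 7735 46656 (by norm_num), hz, hz, hz, hone,
    by simpa using hq 1 6 (by norm_num), mod_cast hq 7 36 (by norm_num),
    mod_cast hq 49 216 (by norm_num), mod_cast hq 343 1296 (by norm_num),
    mod_cast hq 2401 7776 (by norm_num)]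

end Encloses

/-! ### The numerical certificate -/

/-- The digits of the displayed number, as a natural number. -/
def displayedDigits : ℕ :=
  7079764237551105103895553056908184894681711444263208805908873101517293030636657289150619440215929586140643853058236617839038805437427037161983225198843501869295681377649823444071523388800882074553106810227935191220149739931296954376558933192195369394958351011153114111799919088138505138599357264273458295534653653705548720477130373704649449607046275208840820791615363183593786984085594202052884475208247842900518291457801426255494832590823030504774813684129030383618661091994729346316899126658258686744721776623692164339998786486070630256359172293213930131126660661305353727091275283033821909596371164463346351343143276559533679088929433795409592073773399518296416540470294895323623629224992997477760853053903893989731353287187931136704436094234746646663976703439467712341171718619085317407308552387899094073533086262057687143557474061763457398136241182138420814929896478348546126586312504509048656042736191857511098779116613148179664850379978987656091676501299944201086790790737071543289307884197271970205089906775387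

theorem displayedValue_eq : displayedValue = displayedDigits / 10 ^ 1017 := by
  rw [displayedValue, displayedDigits, Nat.cast_ofNat]

/-- The scale of the fixed-point computation. -/
def scale : ℕ := 2 ^ 3460

/-- The reciprocal of the relative precision to which `2 / 7` is approached by the renewal
probabilities `renewal k` with `k ≥ 2 * 4099 - 4`. -/
def precision : ℕ := 10 ^ 450

/-- The data at `n = 3 + 2 ^ 12 = 4099`. -/
def finalState (d : ℕ) : FixedState := (FixedState.initial d scale).iter d scale 12

set_option maxRecDepth 100000 in
/-- The outcome of the computation with quotients rounded down: the first conjunct is the bound on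
the series, cleared of denominators, and the others bound six consecutive renewal probabilities. -/
theorem lower_certificate :
    1512 * scale * precision * displayedDigits
        ≤ 2 * 10 ^ 1017 * (1411 * scale * precision + 36 * precision * (finalState 0).acc
          + 36 * (precision - 10) * (7 * 4099 + 21) * ((finalState 0).x0 + 2 * (finalState 0).x1
            + 3 * (finalState 0).x2 + 4 * (finalState 0).x3 + 5 * (finalState 0).x4)) ∧
      (2 * precision - 1) * scale ≤ 7 * precision * (finalState 0).v0 ∧
      (2 * precision - 1) * scale ≤ 7 * precision * (finalState 0).v1 ∧
      (2 * precision - 1) * scale ≤ 7 * precision * (finalState 0).v2 ∧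
      (2 * precision - 1) * scale ≤ 7 * precision * (finalState 0).v3 ∧
      (2 * precision - 1) * scale ≤ 7 * precision * (finalState 0).v4 ∧
      (2 * precision - 1) * scale ≤ 7 * precision * (finalState 0).v5 := by
  decide +kernel

set_option maxRecDepth 100000 in
/-- The outcome of the computation with quotients rounded up. -/
theorem upper_certificate :
    2 * 10 ^ 1017 * (1411 * scale * precision + 36 * precision * (finalState 1).acc
          + 36 * (precision + 10) * (7 * 4099 + 21) * ((finalState 1).x0 + 2 * (finalState 1).x1
            + 3 * (finalState 1).x2 + 4 * (finalState 1).x3 + 5 * (finalState 1).x4))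
        < 1512 * scale * precision * (displayedDigits + 1) ∧
      7 * precision * (finalState 1).v0 ≤ (2 * precision + 1) * scale ∧
      7 * precision * (finalState 1).v1 ≤ (2 * precision + 1) * scale ∧
      7 * precision * (finalState 1).v2 ≤ (2 * precision + 1) * scale ∧
      7 * precision * (finalState 1).v3 ≤ (2 * precision + 1) * scale ∧
      7 * precision * (finalState 1).v4 ≤ (2 * precision + 1) * scale ∧
      7 * precision * (finalState 1).v5 ≤ (2 * precision + 1) * scale := by
  decide +kernel

/-! ### Conclusion -/

theorem scale_pos : 0 < scale := by unfold scale; positivity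

theorem ten_lt_precision : 10 < precision := by decide +kernel

theorem encloses_finalState {r : ℕ → ℝ → Prop} {d : ℕ} (hr : IsRounding r d) :
    Encloses r scale 4099 (finalState d) :=
  (encloses_initial hr scale).iter hr scale_pos 12 le_rfl

/-- The rounded form of `6 * survival n`. -/
theorem Encloses.survival {r : ℕ → ℝ → Prop} {d K n : ℕ} {s : FixedState} (hr : IsRounding r d)
    (h : Encloses r K n s) :
    r (s.x0 + 2 * s.x1 + 3 * s.x2 + 4 * s.x3 + 5 * s.x4) (6 * K * survival n) := by
  have hx : ∀ j, 0 ≤ K * squareOcc (n ^ 2 + j) := fun j =>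
    mul_nonneg (by positivity) (squareOcc_nonneg _)
  have hm : ∀ {c x : ℕ} {j : ℕ}, r x (K * squareOcc (n ^ 2 + j)) →
      r (c * x) (c * (K * squareOcc (n ^ 2 + j))) := fun h' =>
    hr.mul (by positivity) (hx _) (hr.natCast _) h'
  convert hr.add (hr.add (hr.add (hr.add h.x0 (hm (c := 2) h.x1)) (hm (c := 3) h.x2))
    (hm (c := 4) h.x3)) (hm (c := 5) h.x4) using 1
  rw [survival_eq, add_zero]
  push_cast
  ring

section Arithmetic

variable {K P : ℕ}

/-- Fixed-point bounds for `x` at scale `K`, read as an enclosure of `x` about `2 / 7`. -/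
theorem mem_Icc_of_scaled_bounds {v w : ℕ} {x : ℝ} (hK : 0 < K) (hP : 10 < P)
    (hv : v ≤ K * x) (hw : K * x ≤ w) (h1 : (2 * P - 1) * K ≤ 7 * P * v)
    (h2 : 7 * P * w ≤ (2 * P + 1) * K) :
    x ∈ Set.Icc ((2 - 1 / (P : ℝ)) / 7) ((2 + 1 / (P : ℝ)) / 7) := by
  have hT : (0 : ℝ) < P := by exact_mod_cast (by omega : 0 < P)
  have hK' : (0 : ℝ) < K := by exact_mod_cast hK
  have h1' : (2 * P - 1) * (K : ℝ) ≤ 7 * P * v := by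
    have := Nat.cast_le (α := ℝ).2 h1
    push_cast [Nat.cast_sub (by omega : 1 ≤ 2 * P)] at this
    exact this
  have h2' : 7 * P * w ≤ (2 * P + 1) * (K : ℝ) := by exact_mod_cast h2
  have h3 := mul_le_mul_of_nonneg_left hv (by positivity : 0 ≤ 7 * (P : ℝ))
  have h4 := mul_le_mul_of_nonneg_left hw (by positivity : 0 ≤ 7 * (P : ℝ))
  constructor
  · rw [div_le_iff₀ (by norm_num), sub_le_iff_le_add, ← sub_le_iff_le_add', le_div_iff₀ hT]
    refine le_of_mul_le_mul_right ?_ hK'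
    linarith
  · rw [le_div_iff₀ (by norm_num), ← sub_le_iff_le_add', le_div_iff₀ hT]
    refine le_of_mul_le_mul_right ?_ hK'
    linarith

variable {N c D acc ρ : ℕ} {L S E : ℝ}

/-- A lower fixed-point bound for the series gives a lower bound for `E`. In the hypothesis, `1512`
is `7 * 216`, which clears the denominators of `7 / 2` and of `levelSum 3 = 1411 / 216`. -/
theorem div_le_of_certificate (hK : 0 < K) (hP : 10 < P) (hD : 0 < D)
    (hcert : 1512 * K * P * c
      ≤ 2 * D * (1411 * K * P + 36 * P * acc + 36 * (P - 10) * (7 * N + 21) * ρ))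
    (hacc : acc ≤ 6 * K * (L - 1411 / 216)) (hρ : ρ ≤ 6 * K * S)
    (hE : L + (1 - 10 * (1 / (P : ℝ))) * (7 * N + 21) * S ≤ 7 / 2 * E) : c / D ≤ E := by
  have hP' : (10 : ℝ) < P := by exact_mod_cast hP
  have hK' : (0 : ℝ) < K := by exact_mod_cast hK
  have hD' : (0 : ℝ) < D := by exact_mod_cast hD
  have hcert' := Nat.cast_le (α := ℝ).2 hcert
  push_cast [Nat.cast_sub hP.le] at hcert'
  have hρ' := mul_le_mul_of_nonneg_left hρ
    (mul_nonneg (sub_nonneg.2 hP'.le) (by positivity : (0 : ℝ) ≤ 7 * N + 21))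
  have hacc' := mul_le_mul_of_nonneg_left hacc (by positivity : 0 ≤ (P : ℝ))
  have hE' := mul_le_mul_of_nonneg_left hE (by positivity : 0 ≤ 6 * (K : ℝ) * P)
  have e : 6 * (K : ℝ) * P * (L + (1 - 10 * (1 / (P : ℝ))) * (7 * N + 21) * S)
      = P * (6 * K * L) + (P - 10) * (7 * N + 21) * (6 * K * S) := by
    field_simp
  rw [e] at hE'
  rw [div_le_iff₀ hD']
  refine le_of_mul_le_mul_left (hcert'.trans ?_) (by positivity : (0 : ℝ) < 1512 * K * P)
  have h1 := mul_le_mul_of_nonneg_left (add_le_add hacc' hρ')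
    (by positivity : (0 : ℝ) ≤ 2 * D * 36)
  have h2 := mul_le_mul_of_nonneg_left hE' (by positivity : (0 : ℝ) ≤ 2 * D * 36)
  linarith

theorem lt_div_of_certificate (hK : 0 < K) (hP : 10 < P) (hD : 0 < D)
    (hcert : 2 * D * (1411 * K * P + 36 * P * acc + 36 * (P + 10) * (7 * N + 21) * ρ)
      < 1512 * K * P * (c + 1))
    (hacc : 6 * K * (L - 1411 / 216) ≤ acc) (hρ : 6 * K * S ≤ ρ)
    (hE : 7 / 2 * E ≤ L + (1 + 10 * (1 / (P : ℝ))) * (7 * N + 21) * S) :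
    E < c / D + 1 / D := by
  have hP' : (10 : ℝ) < P := by exact_mod_cast hP
  have hK' : (0 : ℝ) < K := by exact_mod_cast hK
  have hD' : (0 : ℝ) < D := by exact_mod_cast hD
  have hcert' := Nat.cast_lt (α := ℝ).2 hcert
  push_cast at hcert'
  have hρ' := mul_le_mul_of_nonneg_left hρ
    (by positivity : (0 : ℝ) ≤ (P + 10) * (7 * N + 21))
  have hacc' := mul_le_mul_of_nonneg_left hacc (by positivity : 0 ≤ (P : ℝ))
  have hE' := mul_le_mul_of_nonneg_left hE (by positivity : 0 ≤ 6 * (K : ℝ) * P)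
  have e : 6 * (K : ℝ) * P * (L + (1 + 10 * (1 / (P : ℝ))) * (7 * N + 21) * S)
      = P * (6 * K * L) + (P + 10) * (7 * N + 21) * (6 * K * S) := by
    field_simp
  rw [e] at hE'
  rw [← add_div, lt_div_iff₀ hD']
  refine lt_of_mul_lt_mul_left (lt_of_le_of_lt ?_ hcert') (by positivity : (0 : ℝ) ≤ 1512 * K * P)
  have h1 := mul_le_mul_of_nonneg_left (add_le_add hacc' hρ')
    (by positivity : (0 : ℝ) ≤ 2 * D * 36)
  have h2 := mul_le_mul_of_nonneg_left hE' (by positivity : (0 : ℝ) ≤ 2 * D * 36)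
  linarith

end Arithmetic

theorem renewal_mem_Icc_precision {k : ℕ} (hk : 2 * 4099 - 4 ≤ k) :
    renewal k ∈ Set.Icc ((2 - 1 / (precision : ℝ)) / 7) ((2 + 1 / (precision : ℝ)) / 7) := by
  obtain ⟨-, l0, l1, l2, l3, l4, l5⟩ := lower_certificate
  obtain ⟨-, u0, u1, u2, u3, u4, u5⟩ := upper_certificate
  have hl := encloses_finalState isRounding_lower
  have hu := encloses_finalState isRounding_upper
  have hK := scale_pos
  have hP := ten_lt_precision
  exact renewal_mem_Icc (mem_Icc_of_scaled_bounds hK hP hl.v0 hu.v0 l0 u0)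
    (mem_Icc_of_scaled_bounds hK hP hl.v1 hu.v1 l1 u1)
    (mem_Icc_of_scaled_bounds hK hP hl.v2 hu.v2 l2 u2)
    (mem_Icc_of_scaled_bounds hK hP hl.v3 hu.v3 l3 u3)
    (mem_Icc_of_scaled_bounds hK hP hl.v4 hu.v4 l4 u4)
    (mem_Icc_of_scaled_bounds hK hP hl.v5 hu.v5 l5 u5) hk

theorem mainTheorem1 {Ω : Type*} [MeasurableSpace Ω] (μ : Measure Ω) [IsProbabilityMeasure μ]
    (X : ℕ → Ω → ℕ) (hmeas : ∀ i, Measurable (X i)) (hindep : iIndepFun X μ)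
    (hunif : ∀ i, ∀ k ∈ Finset.Icc 1 6, μ {ω | X i ω = k} = 1 / 6) :
    expectedRolls μ X positiveSquares 0 ≠ ∞ ∧
      displayedValue ≤ (expectedRolls μ X positiveSquares 0).toReal ∧
      (expectedRolls μ X positiveSquares 0).toReal < displayedValue + 1 / 10 ^ 1017 := by
  have h0 : 0 ∉ positiveSquares := by
    rintro ⟨n, hn, h⟩
    have : 0 < n ^ 2 := by positivity
    omega
  have hT : (10 : ℝ) < precision := by exact_mod_cast ten_lt_precision
  obtain ⟨hs, hlow, hup⟩ := summable_squareOcc_and_bounds (η := 1 / (precision : ℝ)) (N := 4099)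
    (by positivity) (one_div_le_one_div_of_le (by norm_num) hT.le) (by norm_num)
    fun k hk => renewal_mem_Icc_precision hk
  have hE : expectedRolls μ X positiveSquares 0 = ENNReal.ofReal (∑' m, squareOcc m) := by
    rw [expectedRolls_eq_tsum_occupation hmeas hindep hunif h0,
      ENNReal.ofReal_tsum_of_nonneg squareOcc_nonneg hs]
    rfl
  rw [hE, ENNReal.toReal_ofReal (tsum_nonneg squareOcc_nonneg)]
  have hl := encloses_finalState isRounding_lower
  have hu := encloses_finalState isRounding_upper
  have h3 : levelSum 3 = 1411 / 216 := squareOcc_initial.2.2.2.2.2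
  have hD (m : ℕ) : ((10 ^ m : ℕ) : ℝ) = 10 ^ m := by push_cast; rfl
  refine ⟨ENNReal.ofReal_ne_top, ?_, ?_⟩ <;> rw [displayedValue_eq, ← hD 1017]
  · exact div_le_of_certificate scale_pos ten_lt_precision (Nat.pow_pos (by norm_num))
      lower_certificate.1 (h3 ▸ hl.acc) (hl.survival isRounding_lower) hlow
  · exact lt_div_of_certificate scale_pos ten_lt_precision (Nat.pow_pos (by norm_num))
      upper_certificate.1 (h3 ▸ hu.acc) (hu.survival isRounding_upper) hup
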